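/- All graphs are finite and simple. A snark is a connected bridgeless cubic graph that has no proper edge-coloring with three colors. A $2$-factor of a graph $G$ is a spanning $2$-regular subgraph of $G$; its connected components are cycles, called odd or even according to their length. The oddness of $G$ is the minimum number of odd cycles in a $2$-factor of $G$. A proper $\mathbb{Z}_4\times\mathbb{Z}_2$-coloring of a cubic graph $G$ is a proper edge-coloring $\sigma\colon E(G)\to(\mathbb{Z}_4\times\mathbb{Z}_2)\setminus\{(0,0)\}$ (edges sharing a vertex get distinct colors) such that at every vertex the sum of the colors of the three incident edges is $(0,0)$. **Theorem.** Let $G$ be a snark of oddness two. If $G$ contains a $2$-factor $F$ with precisely two odd cycles and at most one even cycle, then $G$ has a proper $\mathbb{Z}_4\times\mathbb{Z}_2$-coloring. -/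

import Mathlib

namespace SimpleGraph

/-- A cubic graph: every vertex has exactly three neighbours. -/
def IsCubic {V : Type*} (G : SimpleGraph V) : Prop :=
  ∀ v : V, (G.neighborSet v).ncard = 3

/-- No edge of the graph is a bridge. -/
def IsBridgeless {V : Type*} (G : SimpleGraph V) : Prop :=
  ∀ e ∈ G.edgeSet, ¬ G.IsBridge e

/-- A snark: a connected bridgeless cubic graph without a proper 3-edge-coloring.
No condition on the girth or on the cyclic connectivity is imposed. -/
structure IsSnark {V : Type*} (G : SimpleGraph V) : Prop where
  connected : G.Connected
  bridgeless : G.IsBridgeless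
  cubic : G.IsCubic
  not_colorable : ¬ G.lineGraph.Colorable 3

/-- `F` is a 2-factor of `G`: a spanning subgraph in which every vertex has degree two.
In a finite graph its connected components are exactly its cycles. -/
structure IsTwoFactor {V : Type*} (F G : SimpleGraph V) : Prop where
  le : F ≤ G
  degree_eq_two : ∀ v : V, (F.neighborSet v).ncard = 2

/-- The number of odd cycles of a 2-factor `F` (components with an odd number of vertices). -/
noncomputable def numOddCycles {V : Type*} (F : SimpleGraph V) : ℕ :=
  {c : F.ConnectedComponent | Odd c.supp.ncard}.ncard

/-- The number of even cycles of a 2-factor `F` (components with an even number of vertices). -/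
noncomputable def numEvenCycles {V : Type*} (F : SimpleGraph V) : ℕ :=
  {c : F.ConnectedComponent | Even c.supp.ncard}.ncard

/-- The oddness of `G`: the least number of odd cycles in a 2-factor of `G`. -/
noncomputable def oddness {V : Type*} (G : SimpleGraph V) : ℕ :=
  sInf {n : ℕ | ∃ F : SimpleGraph V, F.IsTwoFactor G ∧ F.numOddCycles = n}

/-- `G` has a proper `A`-coloring: a proper edge-coloring (a coloring of the line graph) by
non-zero elements of `A` such that the colors of the edges at each vertex sum to zero. -/
def HasProperAbelianColoring {V : Type*} (G : SimpleGraph V) (A : Type*) [AddCommGroup A] :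
    Prop :=
  ∃ σ : G.lineGraph.Coloring A,
    (∀ e : G.edgeSet, σ e ≠ 0) ∧
      ∀ v : V, ∑ᶠ e ∈ {e : G.edgeSet | v ∈ (e : Sym2 V)}, σ e = 0

end SimpleGraph

/-! At most one even cycle lies between the two odd cycles of `F`, so two edges `m₁`, `m₂` of `G`
suffice to connect them. A Tutte count gives a perfect matching `P` avoiding both
(`exists_isPerfectMatching_deleteEdges`). Then `K = G \ (P \ F)` contains `F`, `m₁` and `m₂`, every
component of `K` has even order, and so `K` carries an edge function `t` over `ZMod 2` with sum 1 at
every vertex (`one_mem_vertexSums`).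

Membership in `F` gives the second coordinate of the color; membership in `F` and `P`, shifted by
`2t`, gives the first. The condition on `t` makes the colors at a vertex sum to zero
(`abelianColor_star`). -/

namespace SimpleGraph

/-! ### Perfect matchings avoiding two prescribed edges -/

section Matching

variable {V : Type*} [Fintype V]

open Classical in
theorem IsCubic.card_filter_adj {G : SimpleGraph V} (h : G.IsCubic) (v : V) :
    (Finset.univ.filter fun w => G.Adj v w).card = 3 := by
  rw [← h v, Set.ncard_eq_toFinset_card']
  congr 1
  ext w
  simp

open Classical in
theorem IsCubic.card_filter_fst_mem {G : SimpleGraph V} (h : G.IsCubic) (K : Finset V) :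
    (Finset.univ.filter fun p : V × V => p.1 ∈ K ∧ G.Adj p.1 p.2).card = 3 * K.card := by
  have : (Finset.univ.filter fun p : V × V => p.1 ∈ K ∧ G.Adj p.1 p.2)
      = K.biUnion fun u => (Finset.univ.filter fun w => G.Adj u w).image fun w => (u, w) := by
    ext ⟨a, b⟩
    simp only [Finset.mem_filter, Finset.mem_univ, true_and, Finset.mem_biUnion,
      Finset.mem_image, Prod.mk.injEq]
    constructor
    · rintro ⟨ha, hab⟩
      exact ⟨a, ha, b, hab, rfl, rfl⟩
    · rintro ⟨u, hu, w, hw, rfl, rfl⟩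
      exact ⟨hu, hw⟩
  rw [this, Finset.card_biUnion]
  · rw [Finset.sum_congr rfl fun u _ => ?_, Finset.sum_const, smul_eq_mul, mul_comm]
    rw [Finset.card_image_of_injective _ (Prod.mk_right_injective u), h.card_filter_adj]
  · intro x _ y _ hxy
    rw [Function.onFun, Finset.disjoint_left]
    intro p hp hq
    simp only [Finset.mem_image] at hp hq
    obtain ⟨_, _, rfl⟩ := hp
    obtain ⟨_, _, h2⟩ := hq
    exact hxy (congrArg Prod.fst h2).symm

-- Swapping endpoints is a fixed-point-free involution on these ordered pairs.
open Classical in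
theorem even_card_filter_adj_inside (G : SimpleGraph V) (K : Finset V) :
    Even (Finset.univ.filter fun p : V × V => (p.1 ∈ K ∧ G.Adj p.1 p.2) ∧ p.2 ∈ K).card := by
  rw [← ZMod.natCast_eq_zero_iff_even, Finset.card_eq_sum_ones, Nat.cast_sum]
  refine Finset.sum_involution (fun p _ => p.swap) ?_ ?_ ?_ ?_
  · intro p _
    decide
  · rintro ⟨a, b⟩ hp _ h
    simp only [Finset.mem_filter, Finset.mem_univ, true_and] at hp
    simp only [Prod.swap_prod_mk, Prod.mk.injEq] at h
    exact hp.1.2.ne h.2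
  · rintro ⟨a, b⟩ hp
    simp only [Finset.mem_filter, Finset.mem_univ, true_and, Prod.swap_prod_mk] at hp ⊢
    exact ⟨⟨hp.2, hp.1.2.symm⟩, hp.1.1⟩
  · intro p _
    exact p.swap_swap

open Classical in
/-- In a bridgeless cubic graph at least three edges leave a vertex set of odd size. -/
theorem IsCubic.three_le_card_boundary {G : SimpleGraph V} (h : G.IsCubic)
    (hb : G.IsBridgeless) {K : Finset V} (hK : Odd K.card) :
    3 ≤ (Finset.univ.filter fun p : V × V => (p.1 ∈ K ∧ G.Adj p.1 p.2) ∧ p.2 ∉ K).card := by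
  -- The degree sum `3 * K.card` is odd and the pairs inside `K` are even in number, so only a
  -- boundary of size 1 must be excluded.
  have hodd : Odd (Finset.univ.filter
      fun p : V × V => (p.1 ∈ K ∧ G.Adj p.1 p.2) ∧ p.2 ∉ K).card := by
    have h1 := h.card_filter_fst_mem K
    rw [← Finset.card_filter_add_card_filter_not (fun p : V × V => p.2 ∈ K),
      Finset.filter_filter, Finset.filter_filter] at h1
    have h2 := G.even_card_filter_adj_inside K
    have h3 : Odd (3 * K.card) := Nat.odd_mul.2 ⟨by decide, hK⟩
    rw [← h1] at h3
    exact (Nat.odd_add'.1 h3).2 h2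
  by_contra hlt
  have h1 : (Finset.univ.filter
      fun p : V × V => (p.1 ∈ K ∧ G.Adj p.1 p.2) ∧ p.2 ∉ K).card = 1 := by
    obtain ⟨k, hk⟩ := hodd
    omega
  obtain ⟨⟨u, w⟩, huw⟩ := Finset.card_eq_one.1 h1
  have hmem : ∀ a b, a ∈ K → G.Adj a b → b ∉ K → a = u ∧ b = w := by
    intro a b ha hab hb'
    have : (a, b) ∈ ({(u, w)} : Finset (V × V)) := by
      rw [← huw]
      simp [ha, hab, hb']
    simpa using this
  have huw' : (u ∈ K ∧ G.Adj u w) ∧ w ∉ K := by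
    have : (u, w) ∈ ({(u, w)} : Finset (V × V)) := Finset.mem_singleton_self _
    rw [← huw] at this
    simpa using this
  refine hb s(u, w) huw'.1.2 ?_
  rw [isBridge_iff]
  rintro ⟨p⟩
  -- Without its only boundary edge, `K` cannot be left, so that edge is a bridge.
  have key : ∀ a b, (G.deleteEdges {s(u, w)}).Walk a b → a ∈ K → b ∈ K := by
    intro a b q
    induction q with
    | nil => exact id
    | cons hadj _ ih =>
      intro ha
      refine ih ?_
      by_contra hc
      rw [deleteEdges_adj] at hadj
      obtain ⟨rfl, rfl⟩ := hmem _ _ ha hadj.1 hc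
      exact hadj.2 rfl
  exact huw'.2 (key _ _ p huw'.1.1)

theorem IsCubic.even_card {G : SimpleGraph V} (h : G.IsCubic) : Even (Nat.card V) := by
  classical
  have h1 := h.card_filter_fst_mem Finset.univ
  have h2 := G.even_card_filter_adj_inside Finset.univ
  simp only [Finset.mem_univ, true_and, and_true] at h1 h2
  rw [h1, Nat.even_mul] at h2
  rw [Nat.card_eq_fintype_card]
  exact h2.resolve_left (by decide)

open Classical in
theorem card_filter_sym2_mk_eq_le (m : Sym2 V) :
    (Finset.univ.filter fun p : V × V => s(p.1, p.2) = m).card ≤ 2 := by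
  induction m with
  | _ a b =>
  refine (Finset.card_le_card (t := {(a, b), (b, a)}) ?_).trans Finset.card_le_two
  rintro ⟨c, d⟩ hp
  simpa using hp

open Classical in
/-- In a bridgeless cubic graph there is a perfect matching avoiding any two given edges. -/
theorem IsCubic.exists_isPerfectMatching_deleteEdges {G : SimpleGraph V} (h : G.IsCubic)
    (hb : G.IsBridgeless) (m₁ m₂ : Sym2 V) :
    ∃ M : (G.deleteEdges {m₁, m₂}).Subgraph, M.IsPerfectMatching := by
  rw [tutte]
  intro S hS
  set G' := G.deleteEdges {m₁, m₂} with hG'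
  set H := ((⊤ : G'.Subgraph).deleteVerts S).coe with hH
  let K : H.ConnectedComponent → Finset V := fun c => (Subtype.val '' c.supp).toFinset
  have hKmem : ∀ c v, v ∈ K c ↔ ∃ hv : v ∈ ((⊤ : G'.Subgraph).deleteVerts S).verts,
      H.connectedComponentMk ⟨v, hv⟩ = c := by
    intro c v
    simp [K, ConnectedComponent.mem_supp_iff]
  have hKcard : ∀ c, (K c).card = c.supp.ncard := by
    intro c
    rw [← Set.ncard_eq_toFinset_card', Set.ncard_image_of_injective _ Subtype.val_injective]
  let B : H.ConnectedComponent → Finset (V × V) := fun c =>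
    Finset.univ.filter fun p : V × V => (p.1 ∈ K c ∧ G.Adj p.1 p.2) ∧ p.2 ∉ K c
  have hlow : 3 * H.oddComponents.ncard ≤ (H.oddComponents.toFinset.biUnion B).card := by
    rw [Finset.card_biUnion, Set.ncard_eq_toFinset_card', mul_comm, ← smul_eq_mul]
    · refine Finset.card_nsmul_le_sum _ _ _ fun c hc => ?_
      refine h.three_le_card_boundary hb ?_
      rw [hKcard]
      simpa using hc
    · intro c _ d _ hcd
      rw [Function.onFun, Finset.disjoint_left]
      rintro ⟨a, b⟩ hp hq
      simp only [B, Finset.mem_filter, Finset.mem_univ, true_and, hKmem] at hp hq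
      obtain ⟨⟨⟨ha, rfl⟩, -⟩, -⟩ := hp
      obtain ⟨⟨⟨_, h2⟩, -⟩, -⟩ := hq
      exact hcd h2
  -- An edge of `G` leaving a component ends in `S` or is `m₁` or `m₂`; each of these two yields at
  -- most two ordered pairs, hence the 4.
  have hupp : (H.oddComponents.toFinset.biUnion B).card ≤ 3 * S.ncard + 4 := by
    have hsub : H.oddComponents.toFinset.biUnion B ⊆
        ((Finset.univ.filter fun p : V × V => p.1 ∈ S.toFinset ∧ G.Adj p.1 p.2).image Prod.swap ∪
          ((Finset.univ.filter fun p : V × V => s(p.1, p.2) = m₁) ∪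
            (Finset.univ.filter fun p : V × V => s(p.1, p.2) = m₂))) := by
      rintro ⟨a, b⟩ hp
      simp only [B, Finset.mem_biUnion, Finset.mem_filter, Finset.mem_univ, true_and] at hp
      obtain ⟨c, -, ⟨hac, hab⟩, hbc⟩ := hp
      simp only [Finset.mem_union, Finset.mem_image, Finset.mem_filter, Finset.mem_univ, true_and,
        Set.mem_toFinset]
      by_cases hbS : b ∈ S
      · exact Or.inl ⟨(b, a), ⟨hbS, hab.symm⟩, rfl⟩
      · right
        by_contra hne
        rw [not_or] at hne
        obtain ⟨ha, hac'⟩ := (hKmem c a).1 hac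
        have hbv : b ∈ ((⊤ : G'.Subgraph).deleteVerts S).verts := by simp [hbS]
        refine hbc ((hKmem c b).2 ⟨hbv, ?_⟩)
        rw [← hac']
        refine ConnectedComponent.sound (Adj.reachable ?_)
        have haS : a ∉ S := by simpa using ha
        simp only [hH, Subgraph.coe_adj, Subgraph.deleteVerts_adj, Subgraph.verts_top,
          Set.mem_univ, Subgraph.top_adj, true_and, hG', deleteEdges_adj]
        refine ⟨hbS, haS, hab.symm, ?_⟩
        rw [Sym2.eq_swap]
        simpa using hne
    refine (Finset.card_le_card hsub).trans ((Finset.card_union_le _ _).trans ?_)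
    refine add_le_add ?_ ((Finset.card_union_le _ _).trans
      (add_le_add (b := 2) (d := 2) (card_filter_sym2_mk_eq_le m₁)
        (card_filter_sym2_mk_eq_le m₂)))
    rw [Finset.card_image_of_injective _ Prod.swap_injective, h.card_filter_fst_mem,
      Set.ncard_eq_toFinset_card']
  have hpar := H.odd_ncard_oddComponents
  have hverts : Nat.card ((⊤ : G'.Subgraph).deleteVerts S).verts + S.ncard = Nat.card V := by
    rw [Nat.card_coe_set_eq, Subgraph.deleteVerts_verts, Subgraph.verts_top, ← Set.compl_eq_univ_sdiff,
      add_comm, Set.ncard_add_ncard_compl]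
  have heven := h.even_card
  rw [← hverts, Nat.even_add, ← Nat.not_odd_iff_even, ← hpar] at heven
  have hlt : S.ncard < H.oddComponents.ncard := hS
  -- The bounds leave only an excess of 1, which contradicts parity because `Nat.card V` is even.
  have h1 : H.oddComponents.ncard = S.ncard + 1 := by omega
  rw [h1, Nat.odd_add_one, Nat.not_odd_iff_even] at heven
  tauto

end Matching

/-! ### Vertex sums of edge functions modulo 2 -/

section VertexSums

variable {V : Type*} [Fintype V]

/-- The functions on the vertices that arise as sums over incident edges of a `ZMod 2`-valued
function supported on the edges of `K`. -/
def vertexSums (K : SimpleGraph V) : AddSubgroup (V → ZMod 2) where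
  carrier := {f | ∃ t : Sym2 V → ZMod 2, (∀ e ∉ K.edgeSet, t e = 0) ∧ ∀ v, ∑ w, t s(v, w) = f v}
  zero_mem' := ⟨0, by simp, by simp⟩
  add_mem' := by
    rintro f g ⟨t, ht, hf⟩ ⟨s, hs, hg⟩
    refine ⟨t + s, fun e he => by simp [ht e he, hs e he], fun v => ?_⟩
    simp [Finset.sum_add_distrib, hf, hg]
  neg_mem' := by
    rintro f ⟨t, ht, hf⟩
    exact ⟨-t, fun e he => by simp [ht e he], fun v => by simp [hf]⟩

open Classical in
theorem Adj.single_add_single_mem_vertexSums {K : SimpleGraph V} {u v : V} (h : K.Adj u v) :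
    (Pi.single u 1 + Pi.single v 1 : V → ZMod 2) ∈ K.vertexSums := by
  refine ⟨Pi.single s(u, v) 1, ?_, ?_⟩
  · intro e he
    refine Pi.single_eq_of_ne ?_ _
    rintro rfl
    exact he h
  · intro x
    have huv := h.ne
    simp only [Pi.add_apply, Pi.single_apply, Sym2.eq_iff]
    by_cases hxu : x = u
    · subst hxu
      simp [huv]
    · by_cases hxv : x = v
      · subst hxv
        simp [hxu]
      · simp [hxu, hxv]

-- Along a walk the contributions of the inner vertices cancel modulo 2.
open Classical in
theorem Reachable.single_add_single_mem_vertexSums {K : SimpleGraph V} {u v : V}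
    (h : K.Reachable u v) :
    (Pi.single u 1 + Pi.single v 1 : V → ZMod 2) ∈ K.vertexSums := by
  obtain ⟨p⟩ := h
  induction p with
  | nil =>
    rw [ZModModule.add_self]
    exact zero_mem _
  | @cons a b c hab _ ih =>
    have := add_mem hab.single_add_single_mem_vertexSums ih
    rwa [add_assoc, ← add_assoc (Pi.single b 1), ZModModule.add_self, zero_add] at this

/-- If `F ≤ K` has exactly two odd components and these lie in one component of `K`, then `K` has
a spanning subgraph all of whose degrees are odd. -/
theorem one_mem_vertexSums {F K : SimpleGraph V} (hle : F ≤ K) {u v : V}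
    (huv : F.connectedComponentMk u ≠ F.connectedComponentMk v)
    (hodd : {c : F.ConnectedComponent | Odd c.supp.ncard} =
      {F.connectedComponentMk u, F.connectedComponentMk v})
    (hreach : K.Reachable u v) : (1 : V → ZMod 2) ∈ K.vertexSums := by
  classical
  -- Moving each vertex to a representative of its `F`-component cancels even components and leaves
  -- one unit per odd one; choosing `u` and `v` as representatives makes the remainder exactly the
  -- pair joined by `hreach`.
  let r : F.ConnectedComponent → V := fun c =>
    if c = F.connectedComponentMk u then u else if c = F.connectedComponentMk v then v else c.out
  have hr : ∀ c, F.connectedComponentMk (r c) = c := by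
    intro c
    simp only [r]
    split_ifs with h1 h2
    · exact h1.symm
    · exact h2.symm
    · exact Quot.out_eq c
  have hone : (1 : V → ZMod 2) = ∑ x, Pi.single x 1 := by
    ext y
    simp [Finset.sum_apply, Pi.single_apply]
  have hsum : ∑ x, (Pi.single (r (F.connectedComponentMk x)) 1 : V → ZMod 2) =
      Pi.single u 1 + Pi.single v 1 := by
    rw [← Finset.sum_fiberwise (s := Finset.univ) (g := F.connectedComponentMk)]
    have hfib : ∀ c : F.ConnectedComponent,
        ∑ x with F.connectedComponentMk x = c,
          (Pi.single (r (F.connectedComponentMk x)) 1 : V → ZMod 2) =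
        if Odd c.supp.ncard then Pi.single (r c) 1 else 0 := by
      intro c
      rw [Finset.sum_congr rfl (g := fun _ => (Pi.single (r c) 1 : V → ZMod 2))
        (fun x hx => by rw [(Finset.mem_filter.1 hx).2]), Finset.sum_const]
      have hc : (Finset.univ.filter fun x => F.connectedComponentMk x = c).card
          = c.supp.ncard := by
        rw [Set.ncard_eq_toFinset_card']
        congr 1
        ext x
        simp [ConnectedComponent.mem_supp_iff]
      rw [hc, ← Nat.cast_smul_eq_nsmul (ZMod 2)]
      split_ifs with ho
      · rw [ZMod.natCast_eq_one_iff_odd.2 ho, one_smul]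
      · rw [ZMod.natCast_eq_zero_iff_even.2 (Nat.not_odd_iff_even.1 ho), zero_smul]
    rw [Finset.sum_congr rfl fun c _ => hfib c, ← Finset.sum_filter]
    have hfilter : (Finset.univ.filter fun c : F.ConnectedComponent => Odd c.supp.ncard) =
        {F.connectedComponentMk u, F.connectedComponentMk v} := by
      ext c
      have := Set.ext_iff.1 hodd c
      simpa using this
    rw [hfilter, Finset.sum_pair huv]
    simp [r, huv.symm]
  have hmem : ∑ x, (Pi.single x 1 + Pi.single (r (F.connectedComponentMk x)) 1 : V → ZMod 2)
      ∈ K.vertexSums := by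
    refine sum_mem fun x _ => Reachable.single_add_single_mem_vertexSums ?_
    exact (ConnectedComponent.exact (hr (F.connectedComponentMk x)).symm).mono hle
  rw [Finset.sum_add_distrib, ← hone, hsum] at hmem
  have := add_mem hmem hreach.single_add_single_mem_vertexSums
  rwa [add_assoc, ZModModule.add_self, add_zero] at this

end VertexSums

/-! ### Joining the two odd cycles -/

section TwoFactor

variable {V : Type*}

theorem Connected.exists_adj_connectedComponentMk_ne {F G : SimpleGraph V} (hG : G.Connected)
    {u v : V} (huv : F.connectedComponentMk u ≠ F.connectedComponentMk v) :
    ∃ a b, G.Adj a b ∧ F.connectedComponentMk a = F.connectedComponentMk u ∧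
      F.connectedComponentMk b ≠ F.connectedComponentMk u := by
  obtain ⟨p⟩ := hG.preconnected u v
  obtain ⟨d, -, h1, h2⟩ := p.exists_boundary_dart
    {x | F.connectedComponentMk x = F.connectedComponentMk u} rfl (fun h => huv h.symm)
  exact ⟨d.fst, d.snd, d.adj, h1, h2⟩

/-- Two odd cycles of a 2-factor with at most one even cycle can be joined by two further edges. -/
theorem Connected.exists_reachable_sup_fromEdgeSet [Finite V] {F G : SimpleGraph V}
    (hG : G.Connected) {u v : V}
    (huv : F.connectedComponentMk u ≠ F.connectedComponentMk v)
    (hodd : {c : F.ConnectedComponent | Odd c.supp.ncard} =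
      {F.connectedComponentMk u, F.connectedComponentMk v})
    (heven : F.numEvenCycles ≤ 1) :
    ∃ m₁ ∈ G.edgeSet, ∃ m₂ ∈ G.edgeSet, (F ⊔ fromEdgeSet {m₁, m₂}).Reachable u v := by
  have hF : ∀ {m₁ m₂ : Sym2 V} {a b : V}, F.connectedComponentMk a = F.connectedComponentMk b →
      (F ⊔ fromEdgeSet {m₁, m₂}).Reachable a b := fun h =>
    (ConnectedComponent.exact h).mono le_sup_left
  obtain ⟨a, b, hab, ha, hb⟩ := hG.exists_adj_connectedComponentMk_ne huv
  obtain ⟨c, d, hcd, hc, hd⟩ := hG.exists_adj_connectedComponentMk_ne huv.symm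
  refine ⟨s(a, b), hab, s(c, d), hcd, ?_⟩
  have hab' : (F ⊔ fromEdgeSet {s(a, b), s(c, d)}).Reachable a b :=
    Adj.reachable (Or.inr (by simp [hab.ne]))
  have hcd' : (F ⊔ fromEdgeSet {s(a, b), s(c, d)}).Reachable c d :=
    Adj.reachable (Or.inr (by simp [hcd.ne]))
  have hub := (hF ha.symm).trans hab'
  have hvd := (hF hc.symm).trans hcd'
  by_cases hbv : F.connectedComponentMk b = F.connectedComponentMk v
  · exact hub.trans (hF hbv)
  by_cases hdu : F.connectedComponentMk d = F.connectedComponentMk u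
  · exact (hvd.trans (hF hdu)).symm
  have hev : ∀ x, F.connectedComponentMk x ≠ F.connectedComponentMk u →
      F.connectedComponentMk x ≠ F.connectedComponentMk v →
      F.connectedComponentMk x ∈ {c : F.ConnectedComponent | Even c.supp.ncard} := by
    intro x h1 h2
    rw [Set.mem_ofPred_eq, ← Nat.not_odd_iff_even]
    intro ho
    have : F.connectedComponentMk x ∈ {c : F.ConnectedComponent | Odd c.supp.ncard} := ho
    rw [hodd] at this
    exact this.elim h1 h2
  -- Neither edge joins the odd cycles directly, so both lead to the unique even cycle.
  have hbd := (Set.ncard_le_one (Set.toFinite _)).1 heven _ (hev b hb hbv) _ (hev d hdu hd)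
  exact (hub.trans (hF hbd)).trans hvd.symm

end TwoFactor

/-! ### Construction of the coloring -/

section Coloring

variable {V : Type*}

/-- The color of an edge: `f` tells whether it lies in the 2-factor, `p` whether it lies in the
second perfect matching, and `x` is the value of the vertex-sum function. -/
def abelianColor (f p : Bool) (x : ZMod 2) : ZMod 4 × ZMod 2 :=
  ((if f = p then 1 else if p then 2 else 0) + (if x = 1 then 2 else 0), if f then 1 else 0)

-- If `p` holds, the colors are `(2, 0)`, `(2y, 1)`, `(2z, 1)`, and `x = 0` keeps the first nonzero.
-- Otherwise, up to exchanging the last two edges, they are `(1 + 2x, 0)`, `(1 + 2y, 1)`, `(2z, 1)`.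
-- In both cases the first coordinates sum to `2 + 2(x + y + z) = 0`.
set_option synthInstance.maxSize 1000 in
theorem abelianColor_star : ∀ (p q r : Bool) (x y z : ZMod 2),
    (p = true ∧ q = false ∧ r = false ∨ p = false ∧ q = true ∧ r = false ∨
      p = false ∧ q = false ∧ r = true) → (p = true → x = 0) → x + y + z = 1 →
    abelianColor false p x + abelianColor true q y + abelianColor true r z = 0 ∧
    abelianColor false p x ≠ 0 ∧ abelianColor true q y ≠ 0 ∧ abelianColor true r z ≠ 0 ∧
    abelianColor false p x ≠ abelianColor true q y ∧
    abelianColor false p x ≠ abelianColor true r z ∧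
    abelianColor true q y ≠ abelianColor true r z := by
  decide

theorem IsTwoFactor.exists_neighbors [Finite V] {F G : SimpleGraph V} (hG : G.IsCubic)
    (hF : F.IsTwoFactor G) (v : V) :
    ∃ a b c, a ≠ b ∧ a ≠ c ∧ b ≠ c ∧ (∀ w, G.Adj v w ↔ w = a ∨ w = b ∨ w = c) ∧
      ∀ w, F.Adj v w ↔ w = b ∨ w = c := by
  obtain ⟨b, c, hbc, hF2⟩ := Set.ncard_eq_two.1 (hF.degree_eq_two v)
  have hle : F.neighborSet v ⊆ G.neighborSet v := fun w hw => hF.le hw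
  have h1 : (G.neighborSet v \ F.neighborSet v).ncard = 1 := by
    rw [Set.ncard_sdiff hle, hG v, hF.degree_eq_two v]
  obtain ⟨a, ha⟩ := Set.ncard_eq_one.1 h1
  have hFw : ∀ w, F.Adj v w ↔ w = b ∨ w = c := fun w => by
    simpa using Set.ext_iff.1 hF2 w
  have haw : ∀ w, (G.Adj v w ∧ ¬ F.Adj v w) ↔ w = a := fun w => by
    simpa using Set.ext_iff.1 ha w
  have haF := ((haw a).2 rfl).2
  rw [hFw, not_or] at haF
  refine ⟨a, b, c, haF.1, haF.2, hbc, fun w => ?_, hFw⟩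
  rw [← haw, ← hFw]
  constructor
  · tauto
  · rintro (h | h)
    exacts [h.1, hF.le h]

/-- A cubic graph with a 2-factor `F` has a proper `ZMod 4 × ZMod 2`-coloring as soon as it has a
perfect matching `P` such that the edges outside `P \ F` contain a spanning subgraph with all
degrees odd. -/
theorem IsTwoFactor.hasProperAbelianColoring [Fintype V] {F G P : SimpleGraph V}
    (hG : G.IsCubic) (hF : F.IsTwoFactor G) (hPG : P ≤ G) (hP : ∀ v, ∃! w, P.Adj v w)
    (h : (1 : V → ZMod 2) ∈ (G \ (P \ F)).vertexSums) :
    G.HasProperAbelianColoring (ZMod 4 × ZMod 2) := by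
  classical
  obtain ⟨t, ht, hsum⟩ := h
  let σ : Sym2 V → ZMod 4 × ZMod 2 := fun e =>
    abelianColor (decide (e ∈ F.edgeSet)) (decide (e ∈ P.edgeSet)) (t e)
  have key : ∀ v, ∃ a b c, a ≠ b ∧ a ≠ c ∧ b ≠ c ∧ (∀ w, G.Adj v w ↔ w = a ∨ w = b ∨ w = c) ∧
      (σ s(v, a) + σ s(v, b) + σ s(v, c) = 0 ∧
      σ s(v, a) ≠ 0 ∧ σ s(v, b) ≠ 0 ∧ σ s(v, c) ≠ 0 ∧
      σ s(v, a) ≠ σ s(v, b) ∧ σ s(v, a) ≠ σ s(v, c) ∧ σ s(v, b) ≠ σ s(v, c)) := by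
    intro v
    obtain ⟨a, b, c, hab, hac, hbc, hGw, hFw⟩ := hF.exists_neighbors hG v
    refine ⟨a, b, c, hab, hac, hbc, hGw, ?_⟩
    have hFa : ¬ F.Adj v a := by rw [hFw]; tauto
    have hFb : F.Adj v b := (hFw b).2 (Or.inl rfl)
    have hFc : F.Adj v c := (hFw c).2 (Or.inr rfl)
    simp only [σ, mem_edgeSet, hFa, hFb, hFc, decide_true, decide_false]
    refine abelianColor_star _ _ _ _ _ _ ?_ ?_ ?_
    · obtain ⟨w, hw, hwu⟩ := hP v
      have hPw : ∀ y, P.Adj v y ↔ y = w := fun y => ⟨hwu y, fun hy => hy ▸ hw⟩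
      simp only [hPw, decide_eq_true_eq, decide_eq_false_iff_not]
      obtain rfl | rfl | rfl := (hGw w).1 (hPG hw)
      · exact Or.inl ⟨rfl, hab.symm, hac.symm⟩
      · exact Or.inr (Or.inl ⟨hab, rfl, hbc.symm⟩)
      · exact Or.inr (Or.inr ⟨hac, hbc, rfl⟩)
    -- The edges of `P \ F` were removed from the support of `t` for this condition.
    · intro hp
      refine ht _ fun hmem => ?_
      rw [mem_edgeSet, sdiff_adj, sdiff_adj] at hmem
      exact hmem.2 ⟨of_decide_eq_true hp, hFa⟩
    · rw [← Pi.one_apply (M := fun _ : V => ZMod 2) v, ← hsum v,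
        ← Finset.sum_subset (Finset.subset_univ {a, b, c})]
      · rw [Finset.sum_insert (by simp [hab, hac]), Finset.sum_pair hbc, add_assoc]
      · intro w _ hw
        refine ht _ fun hmem => hw ?_
        rw [mem_edgeSet, sdiff_adj] at hmem
        simpa using (hGw w).1 hmem.1
  have hadj : ∀ v (e : G.edgeSet), v ∈ (e : Sym2 V) → ∃ w, G.Adj v w ∧ (e : Sym2 V) = s(v, w) := by
    rintro v ⟨e, he⟩ hv
    obtain ⟨w, rfl⟩ := Sym2.mem_iff_exists.1 hv
    exact ⟨w, he, rfl⟩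
  refine ⟨Coloring.mk (fun e => σ e) ?_, ?_, ?_⟩
  · intro e e' hee
    rw [lineGraph_adj_iff_exists] at hee
    obtain ⟨hne, v, hv, hv'⟩ := hee
    obtain ⟨w, hw, hew⟩ := hadj v e hv
    obtain ⟨w', hw', hew'⟩ := hadj v e' hv'
    have hww : w ≠ w' := by
      rintro rfl
      exact hne (Subtype.ext (hew.trans hew'.symm))
    obtain ⟨a, b, c, -, -, -, hGw, -, -, -, -, h1, h2, h3⟩ := key v
    rw [hew, hew']
    obtain rfl | rfl | rfl := (hGw w).1 hw <;> obtain rfl | rfl | rfl := (hGw w').1 hw' <;>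
      first
      | exact absurd rfl hww
      | assumption
      | exact Ne.symm (by assumption)
  · rintro ⟨e, he⟩
    induction e with
    | _ v w =>
    obtain ⟨a, b, c, -, -, -, hGw, -, h1, h2, h3, -⟩ := key v
    change σ s(v, w) ≠ 0
    obtain rfl | rfl | rfl := (hGw w).1 he <;> assumption
  · intro v
    obtain ⟨a, b, c, hab, hac, hbc, hGw, h0, -⟩ := key v
    let ea : G.edgeSet := ⟨s(v, a), (hGw a).2 (by simp)⟩
    let eb : G.edgeSet := ⟨s(v, b), (hGw b).2 (by simp)⟩
    let ec : G.edgeSet := ⟨s(v, c), (hGw c).2 (by simp)⟩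
    have hset : {e : G.edgeSet | v ∈ (e : Sym2 V)} = (({ea, eb, ec} : Finset G.edgeSet) : Set _) := by
      ext e
      simp only [Finset.coe_insert, Finset.coe_singleton, Set.mem_insert_iff,
        Set.mem_singleton_iff, Subtype.ext_iff]
      constructor
      · intro hv
        obtain ⟨w, hw, hew⟩ := hadj v e hv
        rw [hew]
        obtain rfl | rfl | rfl := (hGw w).1 hw
        exacts [Or.inl rfl, Or.inr (Or.inl rfl), Or.inr (Or.inr rfl)]
      · rintro (h | h | h)
        all_goals
          change v ∈ (e : Sym2 V)
          rw [h]
          exact Sym2.mem_mk_left _ _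
    have hne : ∀ {x y : V}, x ≠ y → s(v, x) ≠ s(v, y) := fun hxy h =>
      hxy (Sym2.congr_right.1 h)
    rw [hset, finsum_mem_coe_finset, Finset.sum_insert, Finset.sum_pair, ← add_assoc]
    · exact h0
    · exact fun h => hne hbc (congrArg Subtype.val h)
    · simp only [Finset.mem_insert, Finset.mem_singleton, not_or]
      exact ⟨fun h => hne hab (congrArg Subtype.val h), fun h => hne hac (congrArg Subtype.val h)⟩

/-- A connected bridgeless cubic graph having a 2-factor with precisely two odd cycles and at most
one even cycle has a proper `ZMod 4 × ZMod 2`-coloring. -/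
theorem IsTwoFactor.hasProperAbelianColoring_of_numOddCycles_eq_two [Finite V]
    {F G : SimpleGraph V} (hconn : G.Connected) (hb : G.IsBridgeless) (hG : G.IsCubic)
    (hF : F.IsTwoFactor G) (hF2 : F.numOddCycles = 2) (hF1 : F.numEvenCycles ≤ 1) :
    G.HasProperAbelianColoring (ZMod 4 × ZMod 2) := by
  have := Fintype.ofFinite V
  obtain ⟨c, d, hcd, hodd2⟩ := Set.ncard_eq_two.1 hF2
  induction c using ConnectedComponent.ind with
  | _ u =>
  induction d using ConnectedComponent.ind with
  | _ v =>
  obtain ⟨m₁, hm₁, m₂, hm₂, hreach⟩ :=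
    hconn.exists_reachable_sup_fromEdgeSet hcd hodd2 hF1
  obtain ⟨M, hM⟩ := hG.exists_isPerfectMatching_deleteEdges hb m₁ m₂
  have hMle : M.spanningCoe ≤ G.deleteEdges {m₁, m₂} := M.spanningCoe_le
  refine hF.hasProperAbelianColoring hG (hMle.trans (deleteEdges_le _))
    (Subgraph.isPerfectMatching_iff.1 hM) ?_
  -- Only matching edges outside `F` are removed, so `F` survives, and so do `m₁` and `m₂`, which
  -- the matching avoids.
  have hFK : F ≤ G \ (M.spanningCoe \ F) := fun a b hab => ⟨hF.le hab, fun h => h.2 hab⟩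
  refine one_mem_vertexSums hFK hcd hodd2 (hreach.mono (sup_le hFK ?_))
  intro a b hab
  rw [fromEdgeSet_adj] at hab
  have hab' : s(a, b) = m₁ ∨ s(a, b) = m₂ := hab.1
  refine ⟨?_, fun h => ?_⟩
  · rw [← mem_edgeSet]
    rcases hab' with h | h <;> rwa [h]
  · have := hMle h.1
    rw [deleteEdges_adj] at this
    exact this.2 hab.1

end Coloring

end SimpleGraph

theorem mainTheorem3 {V : Type*} [Finite V] (G : SimpleGraph V)
    (hG : G.IsSnark) (hodd : G.oddness = 2)
    (hF : ∃ F : SimpleGraph V, F.IsTwoFactor G ∧ F.numOddCycles = 2 ∧ F.numEvenCycles ≤ 1) :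
    G.HasProperAbelianColoring (ZMod 4 × ZMod 2) := by
  obtain ⟨F, hF, hF2, hF1⟩ := hF
  exact hF.hasProperAbelianColoring_of_numOddCycles_eq_two hG.connected hG.bridgeless hG.cubic
    hF2 hF1
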